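/- Let $K\in\{\mathbb R,\mathbb C,\mathbb H\}$, $d=\dim_{\mathbb R}K$, and let $G(n)$ be $PO(n,1)$, $PU(n,1)$ or $PSp(n,1)$ respectively, acting on the hyperbolic space $\mathbb H^n_K$ (normalized by $\cosh d(z,w)=|\langle z,w\rangle|/\sqrt{\langle z,z\rangle\langle w,w\rangle}$ on negative vectors of $K^{n,1}$) and on its boundary at infinity $\partial_\infty\mathbb H^n_K$. Assume $d(n-1)\ge 2$ and $m\ge n$. Let $\Gamma\le G(n)$ be a torsion-free uniform lattice and let $(\nu_a)_{a\in\mathbb H^n_K}$ be its Patterson–Sullivan density, that is, a measurable family of probability measures on $\partial_\infty\mathbb H^n_K$ with $\nu_{\gamma a}=\gamma_*\nu_a$ for $\gamma\in\Gamma$ and $\frac{d\nu_a}{d\nu_b}(\xi)=e^{-\delta_\Gamma\beta_b(a,\xi)}$, where $\delta_\Gamma$ is the critical exponent of $\Gamma$ and $\beta_b(a,\xi)=\lim_{s\to\infty}\big(d(a,c(s))-d(b,c(s))\big)$, $c$ being the geodesic ray from $b$ to $\xi$, is the Busemann function. Null sets of $\partial_\infty\mathbb H^n_K$ are taken with respect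 to the common measure class of the $\nu_a$. Let $(X,\mu)$ be a standard Borel probability space without atoms on which $\Gamma$ acts by measure preserving transformations. A measurable cocycle is a measurable map $\sigma:\Gamma\times X\to G(m)$ such that $\sigma(\gamma_1\gamma_2,x)=\sigma(\gamma_1,\gamma_2x)\sigma(\gamma_2,x)$ for all $\gamma_1,\gamma_2\in\Gamma$ and almost every $x$. A boundary map of $\sigma$ is a measurable map $\phi:\partial_\infty\mathbb H^n_K\times X\to\partial_\infty\mathbb H^m_K$ such that, for every $\gamma\in\Gamma$, $\phi(\gamma\xi,\gamma x)=\sigma(\gamma,x)\phi(\xi,x)$ for almost every $(\xi,x)$. The barycenter $\mathrm{bar}(\lambda)$ of a probability measure $\lambda$ on $\partial_\infty\mathbb H^m_K$ without atoms of mass $\ge 1/2$ is the unique minimum point of $a\mapsto\int\beta_o(a,\xi)\,d\lambda(\xi)$, where $o$ is a fixed basepoint. A measurable map $F:\mathbb H^n_K\times X\to\mathbb H^m_K$ is the natural map of $\sigma$ if $\sigma$ has an essentially unique boundary map $\phi$, almost every slice $\phi_x=\phi(\cdot,x)$ is essentially injective (injective on a set of full measure), and, for almost every $x\in X$, $F(a,x)=\mathrm{bar}((\phi_x)_*\nu_a)$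 for every $a\in\mathbb H^n_K$. Let $\sigma:\Gamma\times X\to G(m)$ be a measurable cocycle that admits a natural map $F$, and let $f:X\to G(m)$ be a measurable map. Then $\sigma^f(\gamma,x)=f(\gamma x)^{-1}\sigma(\gamma,x)f(x)$ is a measurable cocycle and its natural map is $$F^f:\mathbb H^n_K\times X\to\mathbb H^m_K,\qquad F^f(a,x)=f(x)^{-1}F(a,x),$$ that is, $F^f$ is a natural map of $\sigma^f$, and every natural map of $\sigma^f$ agrees with $F^f(\cdot,x)$ on all of $\mathbb H^n_K$ for almost every $x\in X$. -/

import Mathlib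

open MeasureTheory Filter Topology
open scoped Quaternion Matrix ENNReal

namespace HypCocycle

noncomputable section

/-! ### The division algebras `ℝ`, `ℂ`, `ℍ` -/

/-- The three families `PO(n,1)`, `PU(n,1)`, `PSp(n,1)`. -/
inductive Family
  | real
  | complex
  | quaternionic

/-- The division algebra of the family: `ℝ`, `ℂ` or the Hamilton quaternions `ℍ[ℝ]`. -/
def Family.K : Family → Type
  | .real => ℝ
  | .complex => ℂ
  | .quaternionic => ℍ[ℝ]

instance : (t : Family) → NormedDivisionRing t.K
  | .real => inferInstanceAs (NormedDivisionRing ℝ)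
  | .complex => inferInstanceAs (NormedDivisionRing ℂ)
  | .quaternionic => inferInstanceAs (NormedDivisionRing ℍ[ℝ])

instance : (t : Family) → NormedAlgebra ℝ t.K
  | .real => inferInstanceAs (NormedAlgebra ℝ ℝ)
  | .complex => inferInstanceAs (NormedAlgebra ℝ ℂ)
  | .quaternionic => inferInstanceAs (NormedAlgebra ℝ ℍ[ℝ])

/-- Conjugation: trivial on `ℝ`, the usual one on `ℂ` and on `ℍ`. -/
instance : (t : Family) → StarRing t.K
  | .real => inferInstanceAs (StarRing ℝ)
  | .complex => inferInstanceAs (StarRing ℂ)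
  | .quaternionic => inferInstanceAs (StarRing ℍ[ℝ])

instance : (t : Family) → FiniteDimensional ℝ t.K
  | .real => inferInstanceAs (FiniteDimensional ℝ ℝ)
  | .complex => inferInstanceAs (FiniteDimensional ℝ ℂ)
  | .quaternionic => inferInstanceAs (FiniteDimensional ℝ ℍ[ℝ])

theorem Family.star_mul_self : (t : Family) → (a : t.K) → star a * a = algebraMap ℝ t.K (‖a‖ ^ 2)
  | .real, a => by
      change ℝ at a
      change a * a = ‖a‖ ^ 2
      rw [Real.norm_eq_abs, sq_abs, sq]
  | .complex, a => by
      change ℂ at a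
      change (starRingEnd ℂ) a * a = ((‖a‖ ^ 2 : ℝ) : ℂ)
      rw [Complex.conj_mul']; push_cast; rfl
  | .quaternionic, a => by
      change ℍ[ℝ] at a
      change star a * a = ((‖a‖ ^ 2 : ℝ) : ℍ[ℝ])
      rw [Quaternion.star_mul_self, Quaternion.normSq_eq_norm_mul_self, sq]

variable (t : Family) (n : ℕ)

/-! ### The isometry groups -/

/-- Index set of the coordinates of `K^{n,1}`. -/
abbrev Idx := Fin n ⊕ Unit

/-- The Gram matrix `diag(1,…,1,-1)`. -/
def J : Matrix (Idx n) (Idx n) t.K := Matrix.diagonal (Sum.elim (fun _ => 1) (fun _ => -1))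

/-- `O(n,1)`, `U(n,1)`, `Sp(n,1)`: the invertible matrices over `K` preserving the Hermitian form
`⟨v,w⟩ = ∑ v̄ᵢ wᵢ - v̄ₙ₊₁ wₙ₊₁` on column vectors (scalars act on the right). -/
def U : Subgroup (Matrix (Idx n) (Idx n) t.K)ˣ where
  carrier := {A | (A : Matrix (Idx n) (Idx n) t.K)ᴴ * J t n * A = J t n}
  one_mem' := by simp
  mul_mem' := by
    intro A B hA hB
    simp only [Set.mem_ofPred_eq] at hA hB ⊢
    rw [Units.val_mul, Matrix.conjTranspose_mul]
    calc _ = (B : Matrix (Idx n) (Idx n) t.K)ᴴ *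
          ((A : Matrix (Idx n) (Idx n) t.K)ᴴ * J t n * A) * B := by noncomm_ring
      _ = _ := by rw [hA, hB]
  inv_mem' := by
    intro A hA
    simp only [Set.mem_ofPred_eq] at hA ⊢
    have h1 : (A : Matrix (Idx n) (Idx n) t.K) * (A⁻¹ : (Matrix (Idx n) (Idx n) t.K)ˣ) = 1 :=
      A.mul_inv
    have h2 : ((A⁻¹ : (Matrix (Idx n) (Idx n) t.K)ˣ) : Matrix (Idx n) (Idx n) t.K)ᴴ *
        (A : Matrix (Idx n) (Idx n) t.K)ᴴ = 1 := by
      rw [← Matrix.conjTranspose_mul, h1, Matrix.conjTranspose_one]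
    set B := ((A⁻¹ : (Matrix (Idx n) (Idx n) t.K)ˣ) : Matrix (Idx n) (Idx n) t.K)
    calc Bᴴ * J t n * B
        = Bᴴ * ((A : Matrix (Idx n) (Idx n) t.K)ᴴ * J t n * A) * B := by rw [hA]
      _ = (Bᴴ * (A : Matrix (Idx n) (Idx n) t.K)ᴴ) * J t n * (A * B) := by noncomm_ring
      _ = J t n := by rw [h1, h2, one_mul, mul_one]

/-- The subgroup of scalar matrices `c • 1` with `c` in the centre of `K`
(that is `±1` for `ℝ` and `ℍ`, the unit circle for `ℂ`). -/
def Z : Subgroup (U t n) where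
  carrier := {A | ∃ c ∈ Subring.center t.K,
    ((A : (Matrix (Idx n) (Idx n) t.K)ˣ) : Matrix (Idx n) (Idx n) t.K) = Matrix.scalar _ c}
  one_mem' := ⟨1, Subring.one_mem _, by simp⟩
  mul_mem' := by
    rintro A B ⟨c, hc, hA⟩ ⟨e, he, hB⟩
    refine ⟨c * e, Subring.mul_mem _ hc he, ?_⟩
    rw [Subgroup.coe_mul, Units.val_mul, hA, hB, map_mul]
  inv_mem' := by
    rintro A ⟨c, hc, hA⟩
    refine ⟨c⁻¹, Set.inv_mem_center hc, ?_⟩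
    have hc0 : c ≠ 0 := by
      rintro rfl
      have h := (A : (Matrix (Idx n) (Idx n) t.K)ˣ).mul_inv
      rw [hA, map_zero, zero_mul] at h
      have := congrFun (congrFun h (Sum.inr ())) (Sum.inr ())
      simp at this
    rw [Subgroup.coe_inv]
    apply Units.inv_eq_of_mul_eq_one_right
    rw [hA, ← map_mul, mul_inv_cancel₀ hc0, map_one]

theorem scalar_comm {c : t.K} (hc : c ∈ Subring.center t.K) (M : Matrix (Idx n) (Idx n) t.K) :
    Matrix.scalar _ c * M = M * Matrix.scalar _ c := by
  ext i j
  simp [Matrix.scalar_apply, Matrix.diagonal_mul, Matrix.mul_diagonal,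
    (Subring.mem_center_iff.1 hc (M i j))]

instance : (Z t n).Normal where
  conj_mem := by
    rintro A ⟨c, hc, hA⟩ g
    refine ⟨c, hc, ?_⟩
    rw [Subgroup.coe_mul, Subgroup.coe_mul, Units.val_mul, Units.val_mul, hA, ← scalar_comm t n hc,
      mul_assoc, ← Units.val_mul, ← Subgroup.coe_mul, mul_inv_cancel]
    simp

/-- `G(n)`: the group `PO(n,1)`, `PU(n,1)` or `PSp(n,1)`, with its quotient topology. -/
def G : Type := U t n ⧸ Z t n

instance : Group (G t n) := inferInstanceAs (Group (U t n ⧸ Z t n))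
instance : TopologicalSpace (G t n) := inferInstanceAs (TopologicalSpace (U t n ⧸ Z t n))
instance : IsTopologicalGroup (G t n) := inferInstanceAs (IsTopologicalGroup (U t n ⧸ Z t n))
instance : MeasurableSpace (G t n) := borel _
instance : BorelSpace (G t n) := ⟨rfl⟩

/-! ### Hyperbolic space and its boundary at infinity -/

/-- The hyperbolic space over `K` of `K`-dimension `n`, in the ball model: `z` stands for the
negative line spanned by `(z, 1)` in `K^{n,1}`. -/
def Hyp : Type := {z : Fin n → t.K // ∑ i, ‖z i‖ ^ 2 < 1}

/-- The boundary at infinity: the unit sphere; `z` stands for the isotropic line spanned by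
`(z, 1)`. -/
def Bdry : Type := {z : Fin n → t.K // ∑ i, ‖z i‖ ^ 2 = 1}

instance : TopologicalSpace (Hyp t n) :=
  inferInstanceAs (TopologicalSpace {z : Fin n → t.K // ∑ i, ‖z i‖ ^ 2 < 1})
instance : MeasurableSpace (Hyp t n) := borel _
instance : BorelSpace (Hyp t n) := ⟨rfl⟩
instance : TopologicalSpace (Bdry t n) :=
  inferInstanceAs (TopologicalSpace {z : Fin n → t.K // ∑ i, ‖z i‖ ^ 2 = 1})
instance : MeasurableSpace (Bdry t n) := borel _
instance : BorelSpace (Bdry t n) := ⟨rfl⟩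

variable {t n}

/-- The vector `(z, 1)`. -/
def lift (z : Fin n → t.K) : Idx n → t.K := Sum.elim z (fun _ => 1)

/-- The fractional linear action: the affine coordinates of the line spanned by `A (z, 1)`. -/
def act (A : Matrix (Idx n) (Idx n) t.K) (z : Fin n → t.K) : Fin n → t.K :=
  fun i => (A *ᵥ lift z) (Sum.inl i) * ((A *ᵥ lift z) (Sum.inr ()))⁻¹

theorem form_eq (v : Idx n → t.K) :
    star v ⬝ᵥ (J t n *ᵥ v) =
      algebraMap ℝ t.K (∑ i, ‖v (Sum.inl i)‖ ^ 2 - ‖v (Sum.inr ())‖ ^ 2) := by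
  rw [map_sub, map_sum]
  simp only [J, Matrix.mulVec_diagonal, dotProduct, Fintype.sum_sum_type, Pi.star_apply,
    Sum.elim_inl, Sum.elim_inr, one_mul, neg_mul, mul_neg, Family.star_mul_self]
  rw [sub_eq_add_neg]
  simp

theorem norm_mulVec (A : U t n) (v : Idx n → t.K) :
    ∑ i, ‖(A.1.1 *ᵥ v) (Sum.inl i)‖ ^ 2 - ‖(A.1.1 *ᵥ v) (Sum.inr ())‖ ^ 2 =
      ∑ i, ‖v (Sum.inl i)‖ ^ 2 - ‖v (Sum.inr ())‖ ^ 2 := by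
  apply (algebraMap ℝ t.K).injective
  rw [← form_eq, ← form_eq, Matrix.star_mulVec, ← Matrix.dotProduct_mulVec, Matrix.mulVec_mulVec,
    Matrix.mulVec_mulVec]
  have h : (A.1.1)ᴴ * J t n * A.1.1 = J t n := A.2
  rw [h]

theorem denom_ne_zero (A : U t n) {z : Fin n → t.K} (hz : ∑ i, ‖z i‖ ^ 2 ≤ 1) :
    (A.1.1 *ᵥ lift z) (Sum.inr ()) ≠ 0 := by
  intro h0
  have h := norm_mulVec A (lift z)
  rw [h0] at h
  simp only [lift, Sum.elim_inl, Sum.elim_inr, norm_zero, norm_one] at h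
  have hs : ∑ i, ‖(A.1.1 *ᵥ lift z) (Sum.inl i)‖ ^ 2 = 0 := by
    apply le_antisymm _ (Finset.sum_nonneg fun i _ => by positivity)
    simp only [lift]
    linarith
  have hw : A.1.1 *ᵥ lift z = 0 := by
    funext i
    rcases i with i | i
    · have := (Finset.sum_eq_zero_iff_of_nonneg (fun i _ => by positivity)).1 hs i (Finset.mem_univ i)
      simpa using this
    · exact h0
  have hv : lift z = 0 := by
    have h1 : (A.1⁻¹).1 *ᵥ (A.1.1 *ᵥ lift z) = 0 := by rw [hw, Matrix.mulVec_zero]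
    rwa [Matrix.mulVec_mulVec, Units.inv_mul, Matrix.one_mulVec] at h1
  have := congrFun hv (Sum.inr ())
  simp [lift] at this

theorem norm_act (A : U t n) {z : Fin n → t.K} (hz : ∑ i, ‖z i‖ ^ 2 ≤ 1) :
    ∑ i, ‖act A.1.1 z i‖ ^ 2 - 1 =
      (∑ i, ‖z i‖ ^ 2 - 1) / ‖(A.1.1 *ᵥ lift z) (Sum.inr ())‖ ^ 2 := by
  have h0 : ‖(A.1.1 *ᵥ lift z) (Sum.inr ())‖ ≠ 0 := norm_ne_zero_iff.2 (denom_ne_zero A hz)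
  have h := norm_mulVec A (lift z)
  have hl : ∑ i, ‖lift z (Sum.inl i)‖ ^ 2 - ‖lift z (Sum.inr ())‖ ^ 2 = ∑ i, ‖z i‖ ^ 2 - 1 := by
    simp [lift]
  rw [← hl, ← h]
  simp only [act, norm_mul, norm_inv, mul_pow, ← Finset.sum_mul]
  field_simp

theorem lift_act (A : U t n) {z : Fin n → t.K} (hz : ∑ i, ‖z i‖ ^ 2 ≤ 1) :
    lift (act A.1.1 z) = fun i => (A.1.1 *ᵥ lift z) i * ((A.1.1 *ᵥ lift z) (Sum.inr ()))⁻¹ := by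
  funext i
  rcases i with i | i
  · rfl
  · exact (mul_inv_cancel₀ (denom_ne_zero A hz)).symm

theorem act_mul (A B : U t n) {z : Fin n → t.K} (hz : ∑ i, ‖z i‖ ^ 2 ≤ 1) :
    act (A * B).1.1 z = act A.1.1 (act B.1.1 z) := by
  have hB := denom_ne_zero B hz
  have key : ∀ i, (A.1.1 *ᵥ lift (act B.1.1 z)) i =
      ((A * B).1.1 *ᵥ lift z) i * ((B.1.1 *ᵥ lift z) (Sum.inr ()))⁻¹ := by
    intro i
    rw [lift_act B hz, Subgroup.coe_mul, Units.val_mul, ← Matrix.mulVec_mulVec]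
    simp only [Matrix.mulVec, dotProduct, Finset.sum_mul, mul_assoc]
  funext i
  simp only [act] at key ⊢
  rw [key, key, mul_inv_rev, inv_inv, mul_assoc, inv_mul_cancel_left₀ hB]

theorem act_one (z : Fin n → t.K) : act (1 : U t n).1.1 z = z := by
  funext i
  simp [act, lift]

theorem act_center {A : U t n} (hA : A ∈ Z t n) (z : Fin n → t.K) : act A.1.1 z = z := by
  obtain ⟨c, hc, h⟩ := hA
  have hc0 : c ≠ 0 := by
    rintro rfl
    have h' := A.1.mul_inv
    rw [h, map_zero, zero_mul] at h'
    have := congrFun (congrFun h' (Sum.inr ())) (Sum.inr ())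
    simp at this
  funext i
  simp only [act, h, Matrix.scalar_apply, Matrix.mulVec_diagonal, lift, Sum.elim_inl, Sum.elim_inr,
    mul_one]
  rw [← Subring.mem_center_iff.1 hc (z i), mul_assoc, mul_inv_cancel₀ hc0, mul_one]

instance : MulAction (U t n) (Hyp t n) where
  smul A z := ⟨act A.1.1 z.1, by
    have h := norm_act A z.2.le
    have h0 : 0 < ‖(A.1.1 *ᵥ lift z.1) (Sum.inr ())‖ := norm_pos_iff.2 (denom_ne_zero A z.2.le)
    have : (∑ i, ‖z.1 i‖ ^ 2 - 1) / ‖(A.1.1 *ᵥ lift z.1) (Sum.inr ())‖ ^ 2 < 0 :=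
      div_neg_of_neg_of_pos (sub_neg.2 z.2) (by positivity)
    linarith⟩
  one_smul z := Subtype.ext (act_one z.1)
  mul_smul A B z := Subtype.ext (act_mul A B z.2.le)

instance : MulAction (U t n) (Bdry t n) where
  smul A z := ⟨act A.1.1 z.1, by
    have h := norm_act A z.2.le
    rw [z.2, sub_self, zero_div] at h
    linarith⟩
  one_smul z := Subtype.ext (act_one z.1)
  mul_smul A B z := Subtype.ext (act_mul A B z.2.le)

/-- The isometric action of `G(n)` on hyperbolic space. -/
instance : MulAction (G t n) (Hyp t n) :=
  MulAction.compHom (Hyp t n) (QuotientGroup.lift (Z t n) (MulAction.toPermHom (U t n) (Hyp t n))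
    (fun _ hA => Equiv.ext fun z => Subtype.ext (act_center hA z.1)))

/-- The action of `G(n)` on the boundary at infinity. -/
instance : MulAction (G t n) (Bdry t n) :=
  MulAction.compHom (Bdry t n) (QuotientGroup.lift (Z t n) (MulAction.toPermHom (U t n) (Bdry t n))
    (fun _ hA => Equiv.ext fun z => Subtype.ext (act_center hA z.1)))

/-- The basepoint `o`: the centre of the ball. -/
def origin : Hyp t n := ⟨fun _ => 0, by simp⟩

/-- The hyperbolic distance,
`cosh d(z,w) = |⟨(z,1),(w,1)⟩| / √(⟨(z,1),(z,1)⟩ ⟨(w,1),(w,1)⟩)`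
(curvature `-1` over `ℝ`, between `-4` and `-1` over `ℂ` and `ℍ`). -/
def hdist (z w : Hyp t n) : ℝ :=
  Real.arcosh (‖1 - ∑ i, star (z.1 i) * w.1 i‖ /
    √((1 - ∑ i, ‖z.1 i‖ ^ 2) * (1 - ∑ i, ‖w.1 i‖ ^ 2)))

/-! ### Busemann functions and barycenters -/

/-- `c` restricted to `[0, ∞)` is a unit speed geodesic ray from `b` to the boundary point `ξ`. -/
structure IsGeodesicRay (c : ℝ → Hyp t n) (b : Hyp t n) (ξ : Bdry t n) : Prop where
  start : c 0 = b
  isometry : ∀ s r : ℝ, 0 ≤ s → 0 ≤ r → hdist (c s) (c r) = |s - r|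
  tendsto : Tendsto (fun s => (c s).1) atTop (𝓝 ξ.1)

/-- The Busemann function `β_b(a, ξ)` pointed at `b`: the limit of `d(a, c(s)) - d(b, c(s))` along a
geodesic ray `c` from `b` to `ξ`. -/
def busemann (b a : Hyp t n) (ξ : Bdry t n) : ℝ :=
  Classical.epsilon fun r : ℝ => ∃ c : ℝ → Hyp t n, IsGeodesicRay c b ξ ∧
    Tendsto (fun s => hdist a (c s) - hdist b (c s)) atTop (𝓝 r)

/-- `Λ_ν(a) = ∫ β_o(a, ξ) dν(ξ)`. -/
def bFunctional (ν : Measure (Bdry t n)) (a : Hyp t n) : ℝ := ∫ ξ, busemann origin a ξ ∂ν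

/-- `p` is the barycenter of the measure `ν`: `ν` has no atom of mass at least `1/2` and `p` is the
unique point at which `Λ_ν` attains its minimum. -/
def IsBarycenter (ν : Measure (Bdry t n)) (p : Hyp t n) : Prop :=
  (∀ ξ, ν {ξ} < 1 / 2) ∧ ∀ q, q ≠ p → bFunctional ν p < bFunctional ν q

/-! ### Lattices and Patterson-Sullivan densities -/

/-- `Γ` is a torsion-free uniform lattice: discrete, cocompact, and without non-trivial elements of
finite order. -/
structure IsTorsionFreeUniformLattice (Γ : Subgroup (G t n)) : Prop where
  discrete : DiscreteTopology Γ
  cocompact : CompactSpace (G t n ⧸ Γ)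
  torsionFree : ∀ γ ∈ Γ, γ ≠ 1 → ¬ IsOfFinOrder γ

/-- The critical exponent `δ_Γ`, through the Poincaré series at the basepoint. -/
def critExp (Γ : Subgroup (G t n)) : ℝ :=
  sInf {s : ℝ | 0 < s ∧ Summable fun γ : Γ => Real.exp (-s * hdist (γ • (origin : Hyp t n)) origin)}

/-- `α`-conformal densities of probability measures for `Γ`. -/
structure IsConformalDensity (Γ : Subgroup (G t n)) (α : ℝ) (ν : Hyp t n → Measure (Bdry t n)) :
    Prop where
  pos : 0 < α
  measurable : Measurable ν
  prob : ∀ a, IsProbabilityMeasure (ν a)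
  equivariant : ∀ (γ : Γ) (a : Hyp t n), ν (γ • a) = (ν a).map (fun ξ => γ • ξ)
  absCont : ∀ a b, a ≠ b → ν a ≪ ν b
  density : ∀ a b, a ≠ b →
    (ν a).rnDeriv (ν b) =ᵐ[ν b] fun ξ => ENNReal.ofReal (Real.exp (-α * busemann b a ξ))

/-- Patterson-Sullivan densities: `δ_Γ`-conformal densities. -/
def IsPattersonSullivan (Γ : Subgroup (G t n)) (ν : Hyp t n → Measure (Bdry t n)) : Prop :=
  IsConformalDensity Γ (critExp Γ) ν

/-! ### Cocycles, boundary maps and natural maps -/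

section Cocycle

variable {m : ℕ} {Γ : Subgroup (G t n)} {X : Type*} [MeasurableSpace X] [MulAction Γ X]

/-- Measurable cocycles `Γ × X → G(m)`. (For discrete `Γ` the map `γ ↦ σ(γ, ·)` is automatically
continuous.) -/
structure IsCocycle (μ : Measure X) (σ : Γ × X → G t m) : Prop where
  measurable : Measurable σ
  cocycle : ∀ γ₁ γ₂ : Γ, ∀ᵐ x ∂μ, σ (γ₁ * γ₂, x) = σ (γ₁, γ₂ • x) * σ (γ₂, x)

/-- The twisted cocycle `σ^f(γ, x) = f(γx)⁻¹ σ(γ, x) f(x)`. -/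
def twist (σ : Γ × X → G t m) (f : X → G t m) : Γ × X → G t m :=
  fun p => (f (p.1 • p.2))⁻¹ * σ p * f p.2

/-- Boundary maps for `σ`: measurable `σ`-equivariant maps `∂H^n × X → ∂H^m`. The boundary
`∂H^n` carries a measure `κ`, of which only the null sets matter. -/
structure IsBoundaryMap (κ : Measure (Bdry t n)) (μ : Measure X) (σ : Γ × X → G t m)
    (φ : Bdry t n × X → Bdry t m) : Prop where
  measurable : Measurable φ
  equivariant : ∀ γ : Γ, ∀ᵐ p ∂(κ.prod μ), φ (γ • p.1, γ • p.2) = σ (γ, p.2) • φ p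

/-- Essential injectivity: injectivity on a set of full measure. -/
def EssInjective {A B : Type*} [MeasurableSpace A] (κ : Measure A) (h : A → B) : Prop :=
  ∃ S : Set A, κ Sᶜ = 0 ∧ Set.InjOn h S

/-- `F` is the natural map of the cocycle `σ` (built with the Patterson-Sullivan density `ν`):
`σ` has an essentially unique boundary map `φ`, almost every slice `φ_x` is essentially injective,
and `F` is a measurable map such that, for almost every `x` and for every `a`, the point `F(a, x)`
is the barycenter of `(φ_x)_* ν_a`. Null sets of `∂H^n` are those of the Patterson-Sullivan
measures, which all have the same null sets. -/
def IsNaturalMap (ν : Hyp t n → Measure (Bdry t n)) (μ : Measure X) (σ : Γ × X → G t m)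
    (F : Hyp t n × X → Hyp t m) : Prop :=
  Measurable F ∧ ∃ φ : Bdry t n × X → Bdry t m,
    IsBoundaryMap (ν origin) μ σ φ ∧
    (∀ ψ, IsBoundaryMap (ν origin) μ σ ψ → ψ =ᵐ[(ν origin).prod μ] φ) ∧
    (∀ᵐ x ∂μ, EssInjective (ν origin) fun ξ => φ (ξ, x)) ∧
    ∀ᵐ x ∂μ, ∀ a, IsBarycenter ((ν a).map fun ξ => φ (ξ, x)) (F (a, x))

end Cocycle

end

end HypCocycle

/-!
Sending a boundary map `φ` of `σ` to `(ξ, x) ↦ f(x)⁻¹ φ(ξ, x)` is a bijection onto the boundary maps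
of `σ^f` (the inverse is the twist by `f⁻¹`), and it respects almost everywhere equality and
essential injectivity of slices. What remains is `bar(g_* λ) = g bar(λ)` for `g ∈ G(m)`. On the
boundary `β_o(a, ξ) = log (|⟨a, ξ⟩| / √(-⟨a, a⟩))`, where `a` and `ξ` are represented by `(a, 1)`
and `(ξ, 1)`; as `g` preserves the form, `β_o(g a, g ξ) - β_o(a, ξ)` depends on `ξ` only. Hence
`Λ_{g_* λ}(g a)` and `Λ_λ(a)` differ by a constant and have corresponding minima.
-/

namespace HypCocycle

noncomputable section

section General

theorem continuousSMul_of_isOpenQuotientMap {M N Y : Type*} [TopologicalSpace M]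
    [TopologicalSpace N] [TopologicalSpace Y] [SMul M Y] [SMul N Y] [ContinuousSMul M Y]
    {π : M → N} (hπ : IsOpenQuotientMap π) (h : ∀ (a : M) (y : Y), π a • y = a • y) :
    ContinuousSMul N Y :=
  ⟨(hπ.prodMap (IsOpenQuotientMap.id (X := Y))).isQuotientMap.continuous_iff.2
    (continuous_smul.congr fun p => (h p.1 p.2).symm)⟩

theorem measurableSMul₂_of_countable (M Y : Type*) [MeasurableSpace M] [MeasurableSpace Y]
    [SMul M Y] [Countable M] [MeasurableSingletonClass M] [MeasurableConstSMul M Y] :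
    MeasurableSMul₂ M Y :=
  ⟨measurable_from_prod_countable_right measurable_const_smul⟩

theorem ae_ae_swap_of_ae_prod {α β : Type*} [MeasurableSpace α] [MeasurableSpace β]
    {κ : Measure α} {μ : Measure β} [SFinite κ] [SFinite μ] {p : α × β → Prop}
    (h : ∀ᵐ z ∂(κ.prod μ), p z) : ∀ᵐ y ∂μ, ∀ᵐ x ∂κ, p (x, y) :=
  Measure.ae_ae_of_ae_prod (Measure.measurePreserving_swap.quasiMeasurePreserving.ae h)

theorem tendsto_arcosh_sub_log :
    Tendsto (fun x : ℝ => Real.arcosh x - Real.log x) atTop (𝓝 (Real.log 2)) := by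
  have hlim : Tendsto (fun x : ℝ => 1 + √(1 - x⁻¹ ^ 2)) atTop (𝓝 2) := by
    have h := ((tendsto_inv_atTop_zero (𝕜 := ℝ).pow 2).const_sub 1).sqrt.const_add 1
    norm_num at h
    simpa using h
  refine (hlim.log two_ne_zero).congr' ?_
  filter_upwards [eventually_gt_atTop 0] with x hx
  have hsqrt : √(x ^ 2 - 1) = x * √(1 - x⁻¹ ^ 2) := by
    rw [← Real.sqrt_sq hx.le, ← Real.sqrt_mul (sq_nonneg x), Real.sqrt_sq hx.le]
    congr 1
    field_simp
  rw [Real.arcosh, hsqrt, ← mul_one_add, Real.log_mul hx.ne' (by positivity), add_sub_cancel_left]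

theorem tendsto_arcosh_mul_sub_arcosh {α : Type*} {l : Filter α} {u v : α → ℝ} {c : ℝ}
    (hu : Tendsto u l (𝓝 c)) (hc : 0 < c) (hv : Tendsto v l atTop) :
    Tendsto (fun s => Real.arcosh (u s * v s) - Real.arcosh (v s)) l (𝓝 (Real.log c)) := by
  have h := ((tendsto_arcosh_sub_log.comp (hu.pos_mul_atTop hc hv)).sub
    (tendsto_arcosh_sub_log.comp hv)).add (hu.log hc.ne')
  rw [sub_self, zero_add] at h
  refine h.congr' ?_
  filter_upwards [hu.eventually_ne hc.ne', hv.eventually_ne_atTop 0] with s hus hvs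
  simp only [Function.comp_apply]
  rw [Real.log_mul hus hvs]
  ring

theorem one_sub_tanh_sq (s : ℝ) : 1 - Real.tanh s ^ 2 = (Real.cosh s ^ 2)⁻¹ := by
  have hcosh := (Real.cosh_pos s).ne'
  rw [Real.tanh_eq_sinh_div_cosh, div_pow, one_sub_div (pow_ne_zero 2 hcosh),
    Real.cosh_sq_sub_sinh_sq, one_div]

theorem one_sub_tanh_mul_tanh (s r : ℝ) :
    1 - Real.tanh s * Real.tanh r = Real.cosh (s - r) / (Real.cosh s * Real.cosh r) := by
  have hcosh := mul_ne_zero (Real.cosh_pos s).ne' (Real.cosh_pos r).ne'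
  rw [Real.tanh_eq_sinh_div_cosh, Real.tanh_eq_sinh_div_cosh, div_mul_div_comm,
    one_sub_div hcosh, Real.cosh_sub]

theorem tendsto_tanh_atTop : Tendsto Real.tanh atTop (𝓝 1) := by
  have hexp : Tendsto (fun s : ℝ => Real.exp (-(2 * s))) atTop (𝓝 0) :=
    Real.tendsto_exp_neg_atTop_nhds_zero.comp (tendsto_id.const_mul_atTop two_pos)
  have h := (hexp.const_sub 1).div (hexp.const_add 1) (by norm_num)
  rw [sub_zero, add_zero, div_one] at h
  refine h.congr fun s => ?_
  have hsplit : Real.exp (-s) = Real.exp s * Real.exp (-(2 * s)) := by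
    rw [← Real.exp_add]
    ring_nf
  rw [Real.tanh_eq, Pi.div_apply, hsplit, ← mul_one_sub, ← mul_one_add,
    mul_div_mul_left _ _ (Real.exp_ne_zero s)]

end General

/-! ### Topology of the groups, of hyperbolic space and of its boundary -/

section Topology

variable (t : Family) (n : ℕ)

instance : T2Space (Bdry t n) :=
  inferInstanceAs (T2Space {z : Fin n → t.K // ∑ i, ‖z i‖ ^ 2 = 1})

instance : CompactSpace (Bdry t n) := by
  have hclosed : IsClosed {z : Fin n → t.K | ∑ i, ‖z i‖ ^ 2 = 1} :=
    isClosed_eq (by fun_prop) continuous_const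
  have hbounded : {z : Fin n → t.K | ∑ i, ‖z i‖ ^ 2 = 1} ⊆ Metric.closedBall 0 1 := by
    intro z (hz : ∑ i, ‖z i‖ ^ 2 = 1)
    rw [mem_closedBall_zero_iff, pi_norm_le_iff_of_nonneg zero_le_one]
    intro i
    rw [← sq_le_one_iff₀ (norm_nonneg _), ← hz]
    exact Finset.single_le_sum (f := fun i => ‖z i‖ ^ 2) (fun _ _ => sq_nonneg _)
      (Finset.mem_univ i)
  exact isCompact_iff_compactSpace.1
    ((isCompact_closedBall _ _).of_isClosed_subset hclosed hbounded)

instance : SecondCountableTopology (Matrix (Idx n) (Idx n) t.K) :=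
  inferInstanceAs (SecondCountableTopology (Idx n → Idx n → t.K))

instance : SecondCountableTopology (Matrix (Idx n) (Idx n) t.K)ˣ :=
  have : SecondCountableTopology (Matrix (Idx n) (Idx n) t.K)ᵐᵒᵖ :=
    MulOpposite.opHomeomorph.symm.isEmbedding.secondCountableTopology
  Units.isEmbedding_embedProduct.secondCountableTopology

instance : SecondCountableTopology (U t n) :=
  IsEmbedding.subtypeVal.secondCountableTopology

instance : SecondCountableTopology (G t n) :=
  inferInstanceAs (SecondCountableTopology (U t n ⧸ Z t n))

variable {t n}

theorem continuous_lift : Continuous (lift : (Fin n → t.K) → Idx n → t.K) :=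
  continuous_pi (Sum.rec continuous_apply fun _ => continuous_const)

theorem continuousOn_act : ContinuousOn (fun p : U t n × (Fin n → t.K) => act p.1.1.1 p.2)
    {p | ∑ i, ‖p.2 i‖ ^ 2 ≤ 1} := by
  have hmulVec : Continuous fun p : U t n × (Fin n → t.K) => p.1.1.1 *ᵥ lift p.2 :=
    (Units.continuous_val.comp (continuous_subtype_val.comp continuous_fst)).matrix_mulVec
      (continuous_lift.comp continuous_snd)
  have hcoord (i : Idx n) :
      Continuous fun p : U t n × (Fin n → t.K) => (p.1.1.1 *ᵥ lift p.2) i :=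
    (continuous_apply i).comp hmulVec
  exact continuousOn_pi.2 fun i => (hcoord (.inl i)).continuousOn.mul
    ((hcoord (.inr ())).continuousOn.inv₀ fun p hp => denom_ne_zero p.1 hp)

instance : ContinuousSMul (U t n) (Hyp t n) :=
  ⟨(continuousOn_act.comp_continuous (continuous_id.prodMap continuous_subtype_val)
    fun p => p.2.2.le).subtype_mk _⟩

instance : ContinuousSMul (U t n) (Bdry t n) :=
  ⟨(continuousOn_act.comp_continuous (continuous_id.prodMap continuous_subtype_val)
    fun p => p.2.2.le).subtype_mk _⟩

instance : ContinuousSMul (G t n) (Hyp t n) :=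
  continuousSMul_of_isOpenQuotientMap (QuotientGroup.isOpenQuotientMap_mk (N := Z t n))
    fun _ _ => rfl

instance : ContinuousSMul (G t n) (Bdry t n) :=
  continuousSMul_of_isOpenQuotientMap (QuotientGroup.isOpenQuotientMap_mk (N := Z t n))
    fun _ _ => rfl

theorem measurableSMul₂_of_discreteTopology (Γ : Subgroup (G t n)) [DiscreteTopology Γ]
    (X : Type*) [MeasurableSpace X] [MulAction Γ X] [MeasurableConstSMul Γ X] :
    MeasurableSMul₂ Γ X :=
  have : Countable Γ := TopologicalSpace.separableSpace_iff_countable.1 inferInstance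
  measurableSMul₂_of_countable Γ X

end Topology

/-! ### The Hermitian form -/

section HermitianForm

variable {t : Family} {n : ℕ}

instance : NormedStarGroup t.K where
  norm_star_le := match t with
    | .real => fun x : ℝ => (norm_star x).le
    | .complex => fun x : ℂ => (norm_star x).le
    | .quaternionic => fun x : ℍ[ℝ] => (norm_star x).le

instance : StarModule ℝ t.K where
  star_smul := match t with
    | .real => fun (r x : ℝ) => star_smul r x
    | .complex => fun (r : ℝ) (x : ℂ) => star_smul r x
    | .quaternionic => fun (r : ℝ) (x : ℍ[ℝ]) => Quaternion.star_smul r x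

/-- The Hermitian form `⟨v, w⟩ = ∑ v̄ᵢ wᵢ - v̄ₙ₊₁ wₙ₊₁` on `K^{n,1}`. -/
def hermForm (v w : Idx n → t.K) : t.K := star v ⬝ᵥ (J t n *ᵥ w)

theorem hermForm_eq (v w : Idx n → t.K) :
    hermForm v w = ∑ i, star (v (.inl i)) * w (.inl i) - star (v (.inr ())) * w (.inr ()) := by
  simp [hermForm, J, Matrix.mulVec_diagonal, dotProduct, sub_eq_add_neg]

theorem hermForm_lift (a w : Fin n → t.K) :
    hermForm (lift a) (lift w) = ∑ i, star (a i) * w i - 1 := by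
  simp [hermForm_eq, lift]

theorem hermForm_mulVec (A : U t n) (v w : Idx n → t.K) :
    hermForm (A.1.1 *ᵥ v) (A.1.1 *ᵥ w) = hermForm v w := by
  have hA : (A.1.1)ᴴ * J t n * A.1.1 = J t n := A.2
  rw [hermForm, hermForm, Matrix.star_mulVec, ← Matrix.dotProduct_mulVec, Matrix.mulVec_mulVec,
    Matrix.mulVec_mulVec, hA]

theorem hermForm_mul_mul (v w : Idx n → t.K) (c e : t.K) :
    hermForm (fun i => v i * c) (fun i => w i * e) = star c * hermForm v w * e := by
  simp only [hermForm_eq, star_mul, mul_sub, sub_mul, Finset.mul_sum, Finset.sum_mul, mul_assoc]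

theorem hermForm_lift_ne_zero {a w : Fin n → t.K} (ha : ∑ i, ‖a i‖ ^ 2 < 1)
    (hw : ∑ i, ‖w i‖ ^ 2 ≤ 1) : hermForm (lift a) (lift w) ≠ 0 := by
  intro h
  rw [hermForm_lift, sub_eq_zero] at h
  have hlt : ‖∑ i, star (a i) * w i‖ < 1 := calc
    ‖∑ i, star (a i) * w i‖ ≤ ∑ i, (‖a i‖ ^ 2 + ‖w i‖ ^ 2) / 2 :=
      norm_sum_le_of_le _ fun i _ => by
        rw [norm_mul, norm_star]
        linarith [two_mul_le_add_sq ‖a i‖ ‖w i‖]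
    _ = (∑ i, ‖a i‖ ^ 2 + ∑ i, ‖w i‖ ^ 2) / 2 := by
      rw [← Finset.sum_div, Finset.sum_add_distrib]
    _ < 1 := by linarith
  rw [h, norm_one] at hlt
  exact lt_irrefl 1 hlt

/-- The denominator of the fractional linear map given by `A`: the last coordinate of
`A (z, 1)`. -/
abbrev denom (A : U t n) (z : Fin n → t.K) : t.K := (A.1.1 *ᵥ lift z) (.inr ())

theorem hermForm_lift_act (A : U t n) {a w : Fin n → t.K} (ha : ∑ i, ‖a i‖ ^ 2 ≤ 1)
    (hw : ∑ i, ‖w i‖ ^ 2 ≤ 1) :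
    hermForm (lift (act A.1.1 a)) (lift (act A.1.1 w)) =
      star (denom A a)⁻¹ * hermForm (lift a) (lift w) * (denom A w)⁻¹ := by
  rw [lift_act A ha, lift_act A hw, hermForm_mul_mul, hermForm_mulVec]

theorem one_sub_norm_sq_act (A : U t n) {a : Fin n → t.K} (ha : ∑ i, ‖a i‖ ^ 2 ≤ 1) :
    1 - ∑ i, ‖act A.1.1 a i‖ ^ 2 = (1 - ∑ i, ‖a i‖ ^ 2) / ‖denom A a‖ ^ 2 := by
  rw [← neg_sub, norm_act A ha, ← neg_div, neg_sub]

theorem norm_sq_smul (r : ℝ) (z : Fin n → t.K) :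
    ∑ i, ‖(r • z) i‖ ^ 2 = r ^ 2 * ∑ i, ‖z i‖ ^ 2 := by
  simp only [Pi.smul_apply, norm_smul, mul_pow, Real.norm_eq_abs, sq_abs, Finset.mul_sum]

theorem hermForm_lift_smul_smul (s r : ℝ) (z : Fin n → t.K) :
    hermForm (lift (s • z)) (lift (r • z)) =
      algebraMap ℝ t.K (s * r * ∑ i, ‖z i‖ ^ 2 - 1) := by
  have hterm (i : Fin n) :
      star ((s • z) i) * (r • z) i = (s * r) • algebraMap ℝ t.K (‖z i‖ ^ 2) := by
    rw [Pi.smul_apply, Pi.smul_apply, star_smul, star_trivial, smul_mul_smul_comm,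
      Family.star_mul_self]
  simp only [hermForm_lift, hterm, ← Finset.smul_sum, ← map_sum]
  rw [map_sub, map_one, map_mul _ (s * r), Algebra.smul_def]

end HermitianForm

/-! ### Busemann functions -/

section Busemann

variable {t : Family} {n : ℕ}

/-- The function `|⟨a, w⟩| / √(-⟨a, a⟩)` with `a` and `w` represented by `(a, 1)` and `(w, 1)`.
For `w` on the boundary it is the exponential of the Busemann function pointed at the origin; it
is defined for all `w` so that it can be followed along rays inside hyperbolic space. -/
def expBusemann (a w : Fin n → t.K) : ℝ :=
  ‖hermForm (lift a) (lift w)‖ / √(1 - ∑ i, ‖a i‖ ^ 2)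

theorem expBusemann_pos {a w : Fin n → t.K} (ha : ∑ i, ‖a i‖ ^ 2 < 1)
    (hw : ∑ i, ‖w i‖ ^ 2 ≤ 1) : 0 < expBusemann a w :=
  div_pos (norm_pos_iff.2 (hermForm_lift_ne_zero ha hw)) (Real.sqrt_pos.2 (sub_pos.2 ha))

theorem continuous_expBusemann (a : Fin n → t.K) : Continuous (expBusemann a) := by
  unfold expBusemann
  simp only [hermForm_lift]
  fun_prop

theorem expBusemann_origin (w : Fin n → t.K) : expBusemann (origin : Hyp t n).1 w = 1 := by
  simp [expBusemann, hermForm_lift, origin]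

theorem expBusemann_act (A : U t n) {a w : Fin n → t.K} (ha : ∑ i, ‖a i‖ ^ 2 ≤ 1)
    (hw : ∑ i, ‖w i‖ ^ 2 ≤ 1) :
    expBusemann (act A.1.1 a) (act A.1.1 w) = expBusemann a w / ‖denom A w‖ := by
  have hdenom : ‖denom A a‖ ≠ 0 := norm_ne_zero_iff.2 (denom_ne_zero A ha)
  rw [expBusemann, expBusemann, hermForm_lift_act A ha hw, one_sub_norm_sq_act A ha,
    Real.sqrt_div (sub_nonneg.2 ha), Real.sqrt_sq (norm_nonneg _), norm_mul, norm_mul, norm_star,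
    norm_inv, norm_inv]
  field_simp

theorem hdist_eq_arcosh_expBusemann (a w : Hyp t n) :
    hdist a w = Real.arcosh (expBusemann a.1 w.1 * (√(1 - ∑ i, ‖w.1 i‖ ^ 2))⁻¹) := by
  rw [hdist, expBusemann, hermForm_lift, norm_sub_rev, Real.sqrt_mul (sub_nonneg.2 a.2.le),
    ← div_eq_mul_inv, div_div]

theorem tendsto_hdist_sub_hdist_origin (a : Hyp t n) (ξ : Bdry t n) {α : Type*} {l : Filter α}
    {c : α → Hyp t n} (hc : Tendsto (fun s => (c s).1) l (𝓝 ξ.1)) :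
    Tendsto (fun s => hdist a (c s) - hdist origin (c s)) l
      (𝓝 (Real.log (expBusemann a.1 ξ.1))) := by
  have hnum : Tendsto (fun s => expBusemann a.1 (c s).1) l (𝓝 (expBusemann a.1 ξ.1)) :=
    ((continuous_expBusemann a.1).tendsto _).comp hc
  have hden : Tendsto (fun s => (√(1 - ∑ i, ‖(c s).1 i‖ ^ 2))⁻¹) l atTop := by
    refine Tendsto.inv_tendsto_nhdsGT_zero (tendsto_nhdsWithin_iff.2
      ⟨?_, .of_forall fun s => Real.sqrt_pos.2 (sub_pos.2 (c s).2)⟩)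
    have hcont : Continuous fun z : Fin n → t.K => √(1 - ∑ i, ‖z i‖ ^ 2) := by fun_prop
    simpa only [Function.comp_def, ξ.2, sub_self, Real.sqrt_zero] using (hcont.tendsto ξ.1).comp hc
  simpa only [hdist_eq_arcosh_expBusemann, expBusemann_origin, one_mul] using
    tendsto_arcosh_mul_sub_arcosh hnum (expBusemann_pos a.2 ξ.2.le) hden

/-- The geodesic ray from the origin to `ξ`. -/
def originRay (ξ : Bdry t n) (s : ℝ) : Hyp t n :=
  ⟨Real.tanh s • ξ.1, by
    rw [norm_sq_smul, ξ.2, mul_one]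
    exact Real.tanh_sq_lt_one s⟩

theorem one_sub_norm_sq_originRay (ξ : Bdry t n) (s : ℝ) :
    1 - ∑ i, ‖(originRay ξ s).1 i‖ ^ 2 = (Real.cosh s ^ 2)⁻¹ := by
  rw [originRay, norm_sq_smul, ξ.2, mul_one, one_sub_tanh_sq]

theorem norm_hermForm_originRay (ξ : Bdry t n) (s r : ℝ) :
    ‖hermForm (lift (originRay ξ s).1) (lift (originRay ξ r).1)‖ =
      Real.cosh (s - r) / (Real.cosh s * Real.cosh r) := by
  have hnonneg := (div_pos (Real.cosh_pos (s - r))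
    (mul_pos (Real.cosh_pos s) (Real.cosh_pos r))).le
  rw [originRay, originRay, hermForm_lift_smul_smul, ξ.2, mul_one, norm_algebraMap', norm_sub_rev,
    one_sub_tanh_mul_tanh, Real.norm_of_nonneg hnonneg]

theorem hdist_originRay (ξ : Bdry t n) (s r : ℝ) :
    hdist (originRay ξ s) (originRay ξ r) = |s - r| := by
  have hs := Real.cosh_pos s
  have hr := Real.cosh_pos r
  rw [hdist, ← norm_sub_rev, ← hermForm_lift, norm_hermForm_originRay, one_sub_norm_sq_originRay,
    one_sub_norm_sq_originRay, ← mul_inv, ← mul_pow, Real.sqrt_inv,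
    Real.sqrt_sq (mul_pos hs hr).le, div_inv_eq_mul, div_mul_cancel₀ _ (mul_pos hs hr).ne',
    ← Real.cosh_abs, Real.arcosh_cosh (abs_nonneg _)]

theorem isGeodesicRay_originRay (ξ : Bdry t n) : IsGeodesicRay (originRay ξ) origin ξ where
  start := Subtype.ext (by funext i; simp [originRay, origin])
  isometry s r _ _ := hdist_originRay ξ s r
  tendsto := by
    simpa only [originRay, one_smul] using tendsto_tanh_atTop.smul_const ξ.1

theorem busemann_origin (a : Hyp t n) (ξ : Bdry t n) :
    busemann origin a ξ = Real.log (expBusemann a.1 ξ.1) := by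
  have hexists : ∃ r : ℝ, ∃ c : ℝ → Hyp t n, IsGeodesicRay c origin ξ ∧
      Tendsto (fun s => hdist a (c s) - hdist origin (c s)) atTop (𝓝 r) :=
    ⟨_, originRay ξ, isGeodesicRay_originRay ξ,
      tendsto_hdist_sub_hdist_origin a ξ (isGeodesicRay_originRay ξ).tendsto⟩
  obtain ⟨c, hc, hlim⟩ := Classical.epsilon_spec hexists
  exact tendsto_nhds_unique hlim (tendsto_hdist_sub_hdist_origin a ξ hc.tendsto)

theorem continuous_busemann_origin (a : Hyp t n) :
    Continuous fun ξ : Bdry t n => busemann origin a ξ := by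
  simp only [busemann_origin]
  exact ((continuous_expBusemann a.1).comp continuous_subtype_val).log
    fun ξ => (expBusemann_pos a.2 ξ.2.le).ne'

theorem busemann_origin_smul (g : G t n) (a : Hyp t n) (ξ : Bdry t n) :
    busemann origin (g • a) (g • ξ) =
      busemann origin a ξ + busemann origin (g • origin) (g • ξ) := by
  obtain ⟨A, hA⟩ := QuotientGroup.mk_surjective (s := Z t n) g
  have hsmul (b : Hyp t n) : busemann origin (g • b) (g • ξ) =
      Real.log (expBusemann b.1 ξ.1) - Real.log ‖denom A ξ.1‖ := by
    rw [busemann_origin, ← hA]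
    change Real.log (expBusemann (act A.1.1 b.1) (act A.1.1 ξ.1)) = _
    rw [expBusemann_act A b.2.le ξ.2.le, Real.log_div (expBusemann_pos b.2 ξ.2.le).ne'
      (norm_ne_zero_iff.2 (denom_ne_zero A ξ.2.le))]
  rw [hsmul, hsmul, expBusemann_origin, Real.log_one, zero_sub, busemann_origin, sub_eq_add_neg]

end Busemann

/-! ### Barycenters -/

section Barycenter

variable {t : Family} {n : ℕ} {ν : Measure (Bdry t n)} {p q : Hyp t n}

theorem integrable_busemann_origin (ν : Measure (Bdry t n)) [IsFiniteMeasure ν] (a : Hyp t n) :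
    Integrable (fun ξ => busemann origin a ξ) ν :=
  (continuous_busemann_origin a).integrable_of_hasCompactSupport (.of_compactSpace _)

theorem bFunctional_map_smul (ν : Measure (Bdry t n)) [IsFiniteMeasure ν] (g : G t n)
    (a : Hyp t n) :
    bFunctional (ν.map fun ξ => g • ξ) (g • a) =
      bFunctional ν a + bFunctional (ν.map fun ξ => g • ξ) (g • origin) := by
  have hg : Measurable fun ξ : Bdry t n => g • ξ := measurable_const_smul g
  have hmap (b : Hyp t n) : bFunctional (ν.map fun ξ => g • ξ) b =
      ∫ ξ, busemann origin b (g • ξ) ∂ν :=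
    integral_map hg.aemeasurable (continuous_busemann_origin b).aestronglyMeasurable
  rw [hmap, hmap, bFunctional]
  simp only [busemann_origin_smul g a]
  exact integral_add (integrable_busemann_origin ν a)
    ((integrable_busemann_origin _ (g • origin)).comp_measurable hg)

theorem IsBarycenter.map_smul [IsFiniteMeasure ν] (h : IsBarycenter ν p) (g : G t n) :
    IsBarycenter (ν.map fun ξ => g • ξ) (g • p) := by
  refine ⟨fun ξ => ?_, fun q hq => ?_⟩
  · have hpreimage : (fun η : Bdry t n => g • η) ⁻¹' {ξ} = {g⁻¹ • ξ} := by
      ext η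
      simp [eq_inv_smul_iff]
    rw [Measure.map_apply (measurable_const_smul g) (measurableSet_singleton ξ), hpreimage]
    exact h.1 _
  · obtain ⟨q, rfl⟩ := MulAction.surjective g q
    rw [bFunctional_map_smul ν g p, bFunctional_map_smul ν g q]
    exact add_lt_add_left (h.2 q (ne_of_apply_ne _ hq)) _

theorem IsBarycenter.unique (hp : IsBarycenter ν p) (hq : IsBarycenter ν q) : p = q := by
  by_contra hne
  exact lt_asymm (hp.2 q (Ne.symm hne)) (hq.2 p hne)

end Barycenter

/-! ### Twisted cocycles and their natural maps -/

theorem IsConformalDensity.absolutelyContinuous {t : Family} {n : ℕ} {Γ : Subgroup (G t n)}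
    {α : ℝ} {ν : Hyp t n → Measure (Bdry t n)} (hν : IsConformalDensity Γ α ν) (a b : Hyp t n) :
    ν a ≪ ν b := by
  rcases eq_or_ne a b with rfl | hab
  · exact .rfl
  · exact hν.absCont a b hab

theorem EssInjective.comp_left {α β γ : Type*} [MeasurableSpace α] {κ : Measure α} {g : β → γ}
    {h : α → β} (hg : Function.Injective g) (hh : EssInjective κ h) :
    EssInjective κ fun a => g (h a) :=
  let ⟨S, hS, hinj⟩ := hh
  ⟨S, hS, fun _ ha _ hb hab => hinj ha hb (hg hab)⟩

section Twist

variable {t : Family} {n m : ℕ} {Γ : Subgroup (G t n)} {X : Type*} [MulAction Γ X]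

theorem twist_twist (σ : Γ × X → G t m) (f g : X → G t m) :
    twist (twist σ f) g = twist σ (f * g) := by
  funext p
  simp only [twist, Pi.mul_apply, mul_inv_rev, mul_assoc]

theorem twist_one (σ : Γ × X → G t m) : twist σ 1 = σ := by
  funext p
  simp only [twist, Pi.one_apply, inv_one, one_mul, mul_one]

variable [MeasurableSpace X] {μ : Measure X} {σ : Γ × X → G t m} {f : X → G t m}

theorem IsCocycle.twist [MeasurableSMul₂ Γ X] (hσ : IsCocycle μ σ) (hf : Measurable f) :
    IsCocycle μ (twist σ f) where
  measurable :=
    ((hf.comp measurable_smul).inv.mul hσ.measurable).mul (hf.comp measurable_snd)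
  cocycle γ₁ γ₂ := by
    filter_upwards [hσ.cocycle γ₁ γ₂] with x hx
    simp only [HypCocycle.twist, hx, mul_smul]
    group

section BoundaryMap

variable {κ : Measure (Bdry t n)} {φ ψ : Bdry t n × X → Bdry t m}

theorem IsBoundaryMap.twist (hφ : IsBoundaryMap κ μ σ φ) (hf : Measurable f) :
    IsBoundaryMap κ μ (twist σ f) fun p => (f p.2)⁻¹ • φ p where
  measurable := (hf.comp measurable_snd).inv.smul hφ.measurable
  equivariant γ := by
    filter_upwards [hφ.equivariant γ] with p hp
    simp only [hp, HypCocycle.twist, smul_smul, mul_inv_cancel_right]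

theorem IsBoundaryMap.of_twist (hψ : IsBoundaryMap κ μ (HypCocycle.twist σ f) ψ)
    (hf : Measurable f) : IsBoundaryMap κ μ σ fun p => f p.2 • ψ p := by
  simpa only [twist_twist, mul_inv_cancel, twist_one, Pi.inv_apply, inv_inv] using hψ.twist hf.inv

theorem IsBoundaryMap.ae_eq_of_twist (hψ : IsBoundaryMap κ μ (HypCocycle.twist σ f) ψ)
    (hf : Measurable f) (hunique : ∀ ψ, IsBoundaryMap κ μ σ ψ → ψ =ᵐ[κ.prod μ] φ) :
    ψ =ᵐ[κ.prod μ] fun p => (f p.2)⁻¹ • φ p := by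
  filter_upwards [hunique _ (hψ.of_twist hf)] with p hp
  rw [← hp, inv_smul_smul]

end BoundaryMap

variable {ν : Hyp t n → Measure (Bdry t n)} {F F' : Hyp t n × X → Hyp t m}

theorem IsNaturalMap.twist [∀ a, IsFiniteMeasure (ν a)] (hF : IsNaturalMap ν μ σ F)
    (hf : Measurable f) : IsNaturalMap ν μ (twist σ f) fun p => (f p.2)⁻¹ • F p := by
  obtain ⟨hmeas, φ, hφ, hunique, hinj, hbar⟩ := hF
  refine ⟨(hf.comp measurable_snd).inv.smul hmeas, fun p => (f p.2)⁻¹ • φ p, hφ.twist hf,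
    fun ψ hψ => hψ.ae_eq_of_twist hf hunique, ?_, ?_⟩
  · filter_upwards [hinj] with x hx
    exact hx.comp_left (MulAction.injective (f x)⁻¹)
  · filter_upwards [hbar] with x hx a
    have hslice : Measurable fun ξ => φ (ξ, x) := hφ.measurable.comp measurable_prodMk_right
    have h := (hx a).map_smul (f x)⁻¹
    rwa [Measure.map_map (measurable_const_smul _) hslice] at h

theorem IsNaturalMap.ae_unique [SFinite μ] [SFinite (ν origin)] (hν : ∀ a, ν a ≪ ν origin)
    (hF : IsNaturalMap ν μ σ F) (hF' : IsNaturalMap ν μ σ F') :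
    ∀ᵐ x ∂μ, ∀ a, F (a, x) = F' (a, x) := by
  obtain ⟨-, φ, hφ, -, -, hbar⟩ := hF
  obtain ⟨-, φ', -, hunique', -, hbar'⟩ := hF'
  filter_upwards [hbar, hbar', ae_ae_swap_of_ae_prod (hunique' φ hφ)] with x hx hx' hslice a
  have h := hx a
  rw [Measure.map_congr ((hν a).ae_le hslice)] at h
  exact h.unique (hx' a)

end Twist

end

end HypCocycle

open HypCocycle in
theorem mainTheorem7_general {t : Family} {n m : ℕ} {Γ : Subgroup (G t n)}
    {ν : Hyp t n → Measure (Bdry t n)} [∀ a, IsFiniteMeasure (ν a)] (hν : ∀ a, ν a ≪ ν origin)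
    {X : Type*} [MeasurableSpace X] [MulAction Γ X] [MeasurableSMul₂ Γ X]
    {μ : Measure X} [SFinite μ] {σ : Γ × X → G t m} (hσ : IsCocycle μ σ)
    {F : Hyp t n × X → Hyp t m} (hF : IsNaturalMap ν μ σ F)
    {f : X → G t m} (hf : Measurable f) :
    IsCocycle μ (twist σ f) ∧
    IsNaturalMap ν μ (twist σ f) (fun p => (f p.2)⁻¹ • F p) ∧
    ∀ F' : Hyp t n × X → Hyp t m, IsNaturalMap ν μ (twist σ f) F' →
      ∀ᵐ x ∂μ, ∀ a, F' (a, x) = (f x)⁻¹ • F (a, x) :=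
  ⟨hσ.twist hf, hF.twist hf, fun _ hF' => hF'.ae_unique hν (hF.twist hf)⟩

theorem mainTheorem7 (t : HypCocycle.Family) (n m : ℕ)
    (hd : 2 ≤ Module.finrank ℝ t.K * (n - 1)) (hnm : n ≤ m)
    (Γ : Subgroup (HypCocycle.G t n)) (hΓ : HypCocycle.IsTorsionFreeUniformLattice Γ)
    (ν : HypCocycle.Hyp t n → Measure (HypCocycle.Bdry t n))
    (hν : HypCocycle.IsPattersonSullivan Γ ν)
    {X : Type*} [MeasurableSpace X] [StandardBorelSpace X] [MulAction Γ X]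
    [MeasurableConstSMul Γ X] (μ : Measure X) [IsProbabilityMeasure μ] [NullSingletonClass μ]
    [SMulInvariantMeasure Γ X μ]
    (σ : Γ × X → HypCocycle.G t m) (hσ : HypCocycle.IsCocycle μ σ)
    (F : HypCocycle.Hyp t n × X → HypCocycle.Hyp t m) (hF : HypCocycle.IsNaturalMap ν μ σ F)
    (f : X → HypCocycle.G t m) (hf : Measurable f) :
    HypCocycle.IsCocycle μ (HypCocycle.twist σ f) ∧
    HypCocycle.IsNaturalMap ν μ (HypCocycle.twist σ f) (fun p => (f p.2)⁻¹ • F p) ∧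
    ∀ F' : HypCocycle.Hyp t n × X → HypCocycle.Hyp t m,
      HypCocycle.IsNaturalMap ν μ (HypCocycle.twist σ f) F' →
      ∀ᵐ x ∂μ, ∀ a, F' (a, x) = (f x)⁻¹ • F (a, x) := by
  have := hΓ.discrete
  have := HypCocycle.measurableSMul₂_of_discreteTopology Γ X
  have := hν.prob
  exact mainTheorem7_general (fun a => hν.absolutelyContinuous a _) hσ hF hf
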